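/- Let $n\ge 1$ and let $\mathcal W_n=\{\lambda\in\mathbb Z^n:\lambda_1\ge\dots\ge\lambda_n\}$ be the set of highest weights of $U(n)$. Let $s_\lambda(\boldsymbol\theta)$, $\lambda\in\mathcal W_n$, denote the Schur Laurent polynomial in $\boldsymbol\theta=(\theta_1,\dots,\theta_n)$, that is, the character of the irreducible representation of $U(n)$ with highest weight $\lambda$: with $\nu_i=\lambda_i-\lambda_n$, $$s_\lambda(\boldsymbol\theta)=(\theta_1\cdots\theta_n)^{\lambda_n}\det\big[h_{\nu_i-i+j}(\boldsymbol\theta)\big]_{1\le i,j\le n},$$ where $h_k$ is the $k$-th complete homogeneous symmetric polynomial and $h_k=0$ for $k<0$. The Littlewood–Richardson coefficients $c_{\lambda\mu}^{\tau}\in\mathbb Z$ ($\lambda,\mu,\tau\in\mathcal W_n$) are the structure constants $s_\lambda s_\mu=\sum_{\tau\in\mathcal W_n}c_{\lambda\mu}^\tau s_\tau$ (a finite sum for fixed $\lambda,\mu$). Let $\theta_1,\dots,\theta_n$ be nonzero complex numbers, and let $F$ be one of the six functions $$F_{\alpha^{\pm},q}(z)=(1-qz^{\pm1})^{-1}\ (0\le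 q<1),\qquad F_{\beta^{\pm},p}(z)=1+pz^{\pm1}\ (0\le p\le 1),\qquad F_{\gamma^{\pm},t}(z)=e^{tz^{\pm1}}\ (t\ge 0).$$ Let $A=\{z: r<|z|<R\}$ with $0\le r<R\le\infty$ be an annulus on which $F$ is analytic and which contains every $\theta_j^{-1}$, and assume that $F(\theta_j^{-1})\ne0$ for all $j$. Put $$f(m)=\frac1{2\pi i}\oint\frac{F(z)}{z^{m+1}}\,dz\qquad(m\in\mathbb Z),$$ the integral being over a positively oriented circle in $A$ centred at the origin. Define the Borodin–Ferrari kernel $$T_n(\boldsymbol\theta;F)(\lambda,\mu)=\frac{s_\mu(\boldsymbol\theta)}{s_\lambda(\boldsymbol\theta)}\cdot\frac{\det\big[f(\lambda_j-j-\mu_i+i)\big]_{1\le i,j\le n}}{\prod_{j=1}^nF(\theta_j^{-1})},\qquad \mathbb P_n(\boldsymbol\theta;F)(\mu)=T_n(\boldsymbol\theta;F)(\mathbf 0,\mu).$$ Let $\lambda,\tau\in\mathcal W_n$, and assume that $s_\lambda(\boldsymbol\theta)\neq0$ and that $s_\mu(\boldsymbol\theta)\ne0$ for every $\mu\in\mathcal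 W_n$ with $c_{\lambda\mu}^\tau\ne0$ (so that the quotients below make sense; terms with $c_{\lambda\mu}^\tau=0$ are read as $0$). Then $$\sum_{\mu\in\mathcal W_n}\mathbb P_n(\boldsymbol\theta;F)(\mu)\,c_{\lambda\mu}^{\tau}\,\frac{s_\tau(\boldsymbol\theta)}{s_\lambda(\boldsymbol\theta)s_\mu(\boldsymbol\theta)}=T_n(\boldsymbol\theta;F)(\lambda,\tau),$$ the sum converging unconditionally. -/

import Mathlib

open scoped ENNReal BigOperators

noncomputable section

/-- The set `𝒲_n` of dominant weights of `U(n)`: nonincreasing `n`-tuples of integers. -/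
abbrev Weight (n : ℕ) : Type := {lam : Fin n → ℤ // Antitone lam}

/-- The zero weight `(0, …, 0)`. -/
def zeroWeight (n : ℕ) : Weight n := ⟨fun _ => 0, antitone_const⟩

/-- The complete homogeneous symmetric polynomial `h_k` at `θ`, with `h_k = 0` for `k < 0`. -/
def completeHomogeneous {n : ℕ} (θ : Fin n → ℂ) (k : ℤ) : ℂ :=
  if 0 ≤ k then MvPolynomial.eval θ (MvPolynomial.hsymm (Fin n) ℂ k.toNat) else 0

/-- The last (smallest) part `λ_n` of a weight; `0` for the empty tuple. -/
def lastPart {n : ℕ} (lam : Weight n) : ℤ :=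
  if h : 0 < n then lam.1 ⟨n - 1, Nat.sub_lt h Nat.one_pos⟩ else 0

/-- The Schur (Laurent) polynomial `s_λ(θ)`, i.e. the character of the irreducible representation
of `U(n)` of highest weight `λ`. For the partition `ν = λ - (λ_n, …, λ_n)` it is the Giambelli
(Jacobi–Trudi) determinant `det [h_{ν_i - i + j}(θ)]`, and in general
`s_λ(θ) = (θ_1 ⋯ θ_n)^{λ_n} s_ν(θ)`. It makes sense also when some of the `θ_i` coincide. -/
def schur {n : ℕ} (lam : Weight n) (θ : Fin n → ℂ) : ℂ :=
  (∏ i, θ i) ^ lastPart lam *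
    (Matrix.of fun i j : Fin n =>
      completeHomogeneous θ (lam.1 i - lastPart lam - (i : ℤ) + (j : ℤ))).det

/-- The finitely supported integer family `c` is the family of coefficients of the expansion
`s_λ s_μ = ∑_τ c_τ s_τ` (as functions on `(ℂ \ {0})^n`). -/
def IsSchurExpansion {n : ℕ} (lam mu : Weight n) (c : Weight n →₀ ℤ) : Prop :=
  ∀ θ : Fin n → ℂ, (∀ i, θ i ≠ 0) →
    schur lam θ * schur mu θ = c.sum fun τ k => (k : ℂ) * schur τ θ

/-- The Littlewood–Richardson coefficient `c_{λμ}^τ`: the coefficient of `s_τ` in the expansion of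
`s_λ s_μ`, equivalently the multiplicity of `V_τ` in `V_λ ⊗ V_μ`. The family of coefficients exists
and is unique, since the `s_τ` form a `ℤ`-basis of the symmetric Laurent polynomials. -/
def lrCoeff {n : ℕ} (lam mu τ : Weight n) : ℤ :=
  Classical.epsilon (IsSchurExpansion lam mu) τ

/-- The open annulus `{z : r < |z| < R}` centred at the origin, `0 ≤ r`, `R ≤ ∞`. -/
def annulus (r R : ℝ≥0∞) : Set ℂ := {z | r < ‖z‖ₑ ∧ ‖z‖ₑ < R}

/-- `f(m) = (2πi)⁻¹ ∮ F(z) / z^{m+1} dz`, over the positively oriented circle `|z| = ρ`. -/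
def laurentCoeff (F : ℂ → ℂ) (ρ : ℝ) (m : ℤ) : ℂ :=
  (2 * (Real.pi : ℂ) * Complex.I)⁻¹ * ∮ z in C(0, ρ), F z / z ^ (m + 1)

/-- The Borodin–Ferrari transition kernel
`T_n(θ; F)(λ, μ) = (s_μ(θ) / s_λ(θ)) det [f(λ_j - j - μ_i + i)] / ∏_j F(θ_j⁻¹)`,
the numbers `f(m)` being computed on the circle `|z| = ρ`. -/
def transitionKernel {n : ℕ} (θ : Fin n → ℂ) (F : ℂ → ℂ) (ρ : ℝ) (lam mu : Weight n) : ℂ :=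
  schur mu θ / schur lam θ *
    ((Matrix.of fun i j : Fin n =>
        laurentCoeff F ρ (lam.1 j - (j : ℤ) - mu.1 i + (i : ℤ))).det /
      ∏ j, F ((θ j)⁻¹))

/-- The weights `P_n(θ; F)(μ) = T_n(θ; F)(0, μ)`. -/
def initialWeight {n : ℕ} (θ : Fin n → ℂ) (F : ℂ → ℂ) (ρ : ℝ) (mu : Weight n) : ℂ :=
  transitionKernel θ F ρ (zeroWeight n) mu

/-- The six families of functions `F_ξ`, `ξ = α^±, β^±, γ^±`. -/
inductive IsBasicFunction : (ℂ → ℂ) → Prop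
  | alphaPlus (q : ℝ) (h0 : 0 ≤ q) (h1 : q < 1) :
      IsBasicFunction fun z => (1 - (q : ℂ) * z)⁻¹
  | alphaMinus (q : ℝ) (h0 : 0 ≤ q) (h1 : q < 1) :
      IsBasicFunction fun z => (1 - (q : ℂ) * z⁻¹)⁻¹
  | betaPlus (p : ℝ) (h0 : 0 ≤ p) (h1 : p ≤ 1) :
      IsBasicFunction fun z => 1 + (p : ℂ) * z
  | betaMinus (p : ℝ) (h0 : 0 ≤ p) (h1 : p ≤ 1) :
      IsBasicFunction fun z => 1 + (p : ℂ) * z⁻¹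
  | gammaPlus (t : ℝ) (h0 : 0 ≤ t) :
      IsBasicFunction fun z => Complex.exp ((t : ℂ) * z)
  | gammaMinus (t : ℝ) (h0 : 0 ≤ t) :
      IsBasicFunction fun z => Complex.exp ((t : ℂ) * z⁻¹)

end

noncomputable section

open Finset

/-! Write `a_λ` for the alternant with exponents `λ_i - i`, so that `s_λ a_0 = a_λ`
(`schurPoly_mul_alternant`). For any `f : ℤ → ℂ`, the additive functional `Φ_f : x^m ↦ ∏ f(-m_j)`
sends `a_λ(x⁻¹) a_τ(x)` to `n! det[f(λ_j - j - τ_i + i)]` (`functional_invVars_alternant_mul`).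

Taking `f = δ_0` gives orthogonality of the alternants under the constant term. Hence, for fixed `λ`
and `τ`, the `c_{λμ}^τ` are the coefficients in the finite expansion `s_λ(x⁻¹) a_τ = ∑_μ c_{λμ}^τ
a_μ` (`exists_sum_lrCoeff_dual`), and the sum over `μ` is finite. Multiplying by `a_0(x⁻¹)` and
applying `Φ_f` with `f` the Laurent coefficients of `F` expresses the determinant for `(λ, τ)`
through those for `(0, μ)` (`sum_lrCoeff_mul_det`). The Schur quotients then cancel, since `s_0 =
1`. -/

/-! ### Jacobi–Trudi determinants and alternants -/

/-- The complete homogeneous symmetric polynomial `h_k` at a tuple in a commutative ring, with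
`h_k = 0` for `k < 0`. -/
def hsymmAt {A : Type*} [CommRing A] {n : ℕ} (x : Fin n → A) (k : ℤ) : A :=
  if 0 ≤ k then MvPolynomial.aeval x (MvPolynomial.hsymm (Fin n) ℤ k.toNat) else 0

lemma completeHomogeneous_eq_hsymmAt {n : ℕ} (θ : Fin n → ℂ) (k : ℤ) :
    completeHomogeneous θ k = hsymmAt θ k := by
  unfold completeHomogeneous hsymmAt
  split_ifs
  · rw [← MvPolynomial.map_hsymm (Fin n) ℤ k.toNat (Int.castRingHom ℂ), MvPolynomial.eval_map]
    rfl
  · rfl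

lemma map_hsymmAt {A B : Type*} [CommRing A] [CommRing B] {n : ℕ} (g : A →+* B) (x : Fin n → A)
    (k : ℤ) : g (hsymmAt x k) = hsymmAt (fun i => g (x i)) k := by
  unfold hsymmAt
  split_ifs
  · rw [MvPolynomial.aeval_def, MvPolynomial.aeval_def, MvPolynomial.hom_eval₂]
    congr 1
    exact RingHom.ext_int _ _
  · exact map_zero g

lemma aeval_hsymm_eq_sum {A : Type*} [CommRing A] {n : ℕ} (x : Fin n → A) (k : ℕ) :
    MvPolynomial.aeval x (MvPolynomial.hsymm (Fin n) ℤ k) =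
      ∑ l ∈ univ.finsuppAntidiag k, ∏ i, x i ^ l i := by
  rw [MvPolynomial.hsymm, map_sum]
  refine Finset.sum_bij (fun s _ => Multiset.toFinsupp s.1) ?_ ?_ ?_ ?_
  · intro s _
    simp only [mem_finsuppAntidiag, subset_univ, and_true]
    exact (Multiset.sum_count_eq_card fun a _ => mem_univ a).trans s.2
  · intro s _ t _ h
    exact Subtype.ext (Multiset.toFinsupp.injective h)
  · intro l hl
    simp only [mem_finsuppAntidiag, subset_univ, and_true] at hl
    refine ⟨⟨Finsupp.toMultiset l, ?_⟩, mem_univ _, ?_⟩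
    · rw [Finsupp.card_toMultiset, Finsupp.sum_fintype _ _ (fun _ => rfl)]
      exact hl
    · exact Finsupp.toMultiset_toFinsupp l
  · intro s _
    simp only [Multiset.toFinsupp_apply]
    rw [map_multiset_prod, Multiset.map_map]
    simp only [Function.comp_def, MvPolynomial.aeval_X]
    exact Finset.prod_multiset_map_count s.1 x |>.trans
      (Finset.prod_subset (subset_univ _) (fun i _ hi => by
        rw [Multiset.mem_toFinset] at hi
        rw [Multiset.count_eq_zero_of_notMem hi, pow_zero]))

lemma mk_pow_mul_one_sub {A : Type*} [CommRing A] (y : A) :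
    PowerSeries.mk (fun k => y ^ k) * ((1 - Polynomial.C y * Polynomial.X : Polynomial A) :
      PowerSeries A) = 1 := by
  ext k
  rcases k with _ | k
  · simp [mul_sub, ← mul_assoc]
  · simp [mul_sub, ← mul_assoc, pow_succ, PowerSeries.coeff_succ_mul_X, PowerSeries.coeff_one]

/-- `∏_{i ≠ l} (1 - x_i X)`. -/
def erasedProd {A : Type*} [CommRing A] {n : ℕ} (x : Fin n → A) (l : Fin n) : Polynomial A :=
  ∏ i ∈ univ.erase l, (1 - Polynomial.C (x i) * Polynomial.X)

lemma natDegree_erasedProd_lt {A : Type*} [CommRing A] {n : ℕ} (x : Fin n → A) (l : Fin n) :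
    (erasedProd x l).natDegree < n := by
  have h : (erasedProd x l).natDegree ≤ ∑ i ∈ univ.erase l, 1 :=
    (Polynomial.natDegree_prod_le _ _).trans (sum_le_sum fun i _ => by compute_degree)
  have hn : 0 < n := l.pos
  simp [card_erase_of_mem] at h
  omega

/-- The generating series of the `h_k` is `∏_i (1 - x_i X)⁻¹`; all factors but the `l`-th cancel. -/
lemma mk_hsymm_mul_erasedProd {A : Type*} [CommRing A] {n : ℕ} (x : Fin n → A) (l : Fin n) :
    PowerSeries.mk (fun k => hsymmAt x k) * (erasedProd x l : PowerSeries A) =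
      PowerSeries.mk fun k => x l ^ k := by
  have h : PowerSeries.mk (fun k : ℕ => hsymmAt x k) = ∏ i, PowerSeries.mk fun k => x i ^ k := by
    ext k
    rw [PowerSeries.coeff_prod]
    simp [hsymmAt, aeval_hsymm_eq_sum]
  rw [h, ← mul_prod_erase _ _ (mem_univ l), mul_assoc, erasedProd,
    ← Polynomial.coeToPowerSeries.ringHom_apply, map_prod, ← prod_mul_distrib, prod_eq_one,
    mul_one]
  intro i _
  exact mk_pow_mul_one_sub (x i)

lemma sum_hsymmAt_mul_coeff_erasedProd {A : Type*} [CommRing A] {n : ℕ} (x : Fin n → A)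
    (l : Fin n) (a : ℕ) :
    ∑ j : Fin n, hsymmAt x ((a : ℤ) - (n - 1) + j) * (erasedProd x l).coeff (n - 1 - j) =
      x l ^ a := by
  have h := congrArg (PowerSeries.coeff a) (mk_hsymm_mul_erasedProd x l)
  rw [mul_comm, PowerSeries.coeff_mul, PowerSeries.coeff_mk,
    Nat.sum_antidiagonal_eq_sum_range_succ_mk] at h
  simp only [Polynomial.coeff_coe, PowerSeries.coeff_mk] at h
  -- Reversing `j ↦ n - 1 - j` turns the sum into a truncated Cauchy product.
  rw [← h, ← Equiv.sum_comp Fin.revPerm]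
  have h1 : ∀ j : Fin n, hsymmAt x ((a : ℤ) - (n - 1) + (Fin.revPerm j : Fin n)) *
      (erasedProd x l).coeff (n - 1 - (Fin.revPerm j : Fin n)) =
      (fun i : ℕ => hsymmAt x ((a : ℤ) - i) * (erasedProd x l).coeff i) j := by
    intro j
    have hj := j.2
    simp only [Fin.revPerm_apply, Fin.val_rev]
    congr 2
    · push_cast [Nat.cast_sub (show (j : ℕ) + 1 ≤ n from hj)]
      ring
    · omega
  rw [Finset.sum_congr rfl fun j _ => h1 j, Fin.sum_univ_eq_sum_range
    (fun i : ℕ => hsymmAt x ((a : ℤ) - i) * (erasedProd x l).coeff i) n]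
  -- The truncations at `n` and at `a + 1` agree: beyond the first the polynomial has no
  -- coefficients, beyond the second `h` has negative index.
  have h2 : ∀ N : ℕ, n ≤ N → a + 1 ≤ N →
      (∑ i ∈ range n, hsymmAt x ((a : ℤ) - i) * (erasedProd x l).coeff i =
        ∑ i ∈ range N, hsymmAt x ((a : ℤ) - i) * (erasedProd x l).coeff i) ∧
      (∑ i ∈ range (a + 1), hsymmAt x ((a : ℤ) - i) * (erasedProd x l).coeff i =
        ∑ i ∈ range N, hsymmAt x ((a : ℤ) - i) * (erasedProd x l).coeff i) := by
    intro N h1 h2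
    constructor
    · refine sum_subset (range_subset_range.2 h1) fun i _ hi => ?_
      rw [Polynomial.coeff_eq_zero_of_natDegree_lt, mul_zero]
      have := natDegree_erasedProd_lt x l
      simp at hi
      omega
    · refine sum_subset (range_subset_range.2 h2) fun i _ hi => ?_
      rw [hsymmAt, if_neg, zero_mul]
      simp at hi
      omega
  obtain ⟨e1, e2⟩ := h2 (max n (a + 1)) (le_max_left _ _) (le_max_right _ _)
  rw [e1, ← e2]
  refine sum_congr rfl fun i hi => ?_
  rw [mul_comm, Nat.cast_sub (by simp at hi; omega)]

/-- The equality of the Jacobi–Trudi determinant with the ratio of alternants. -/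
lemma det_hsymmAt_mul_det_pow {A : Type*} [CommRing A] {n : ℕ} (x : Fin n → A) (a : Fin n → ℕ) :
    (Matrix.of fun i j : Fin n => hsymmAt x ((a i : ℤ) - (n - 1) + j)).det *
        (Matrix.of fun i l : Fin n => x l ^ (n - 1 - (i : ℕ))).det =
      (Matrix.of fun i l : Fin n => x l ^ a i).det := by
  have key : ∀ b : Fin n → ℕ, (Matrix.of fun i j : Fin n => hsymmAt x ((b i : ℤ) - (n - 1) + j)) *
      (Matrix.of fun j l : Fin n => (erasedProd x l).coeff (n - 1 - j)) =
      Matrix.of fun i l : Fin n => x l ^ b i := by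
    intro b
    ext i l
    simp only [Matrix.mul_apply, Matrix.of_apply]
    exact sum_hsymmAt_mul_coeff_erasedProd x l (b i)
  rw [← key a, Matrix.det_mul, ← key fun i => n - 1 - i, Matrix.det_mul]
  -- For the exponents `n - 1 - i` the matrix is `h_{j-i}`, which is unitriangular.
  have h1 : (Matrix.of fun i j : Fin n =>
      hsymmAt x (((n - 1 - (i : ℕ) : ℕ) : ℤ) - (n - 1) + j)).det = 1 := by
    have e : ∀ i j : Fin n, (((n - 1 - (i : ℕ) : ℕ) : ℤ) - (n - 1) + j) = (j : ℤ) - i := by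
      intro i j
      have := i.2
      omega
    simp only [e]
    rw [Matrix.det_of_isUpperTriangular]
    · simp [hsymmAt]
    · intro i j hij
      simp only [Matrix.of_apply, hsymmAt]
      rw [if_neg]
      have : (j : ℕ) < i := hij
      omega
  rw [h1, one_mul]

/-! ### Laurent polynomials, alternants and Schur polynomials -/

/-- Integral Laurent polynomials in `n` variables. -/
abbrev Laurent (n : ℕ) : Type := AddMonoidAlgebra ℤ (Fin n → ℤ)

namespace Laurent

variable {n : ℕ}

/-- The monomial `x^m`. -/
def monom (m : Fin n → ℤ) : Laurent n := AddMonoidAlgebra.single m 1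

lemma monom_mul (m k : Fin n → ℤ) : monom m * monom k = monom (m + k) := by
  simp [monom, AddMonoidAlgebra.single_mul_single]

lemma monom_zero : monom (0 : Fin n → ℤ) = 1 := rfl

lemma prod_monom {ι : Type*} (s : Finset ι) (m : ι → Fin n → ℤ) :
    ∏ i ∈ s, monom (m i) = monom (∑ i ∈ s, m i) := by
  classical
  induction s using Finset.induction_on with
  | empty => simp [monom_zero]
  | insert a s ha ih => rw [prod_insert ha, sum_insert ha, ih, monom_mul]

lemma monom_pow (m : Fin n → ℤ) (k : ℕ) : monom m ^ k = monom (k • m) := by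
  simp [monom, AddMonoidAlgebra.single_pow]

/-- The alternant `a_m = ∑_σ sgn(σ) x^{m ∘ σ}`. -/
def alternant (m : Fin n → ℤ) : Laurent n :=
  ∑ σ : Equiv.Perm (Fin n), Equiv.Perm.sign σ • monom (m ∘ σ)

/-- The variable `x_l`. -/
def var (l : Fin n) : Laurent n := monom (Pi.single l 1)

lemma det_var_pow (a : Fin n → ℕ) :
    (Matrix.of fun i l : Fin n => (var l : Laurent n) ^ a i).det =
      alternant fun i => (a i : ℤ) := by
  rw [Matrix.det_apply, alternant]
  refine sum_congr rfl fun σ _ => ?_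
  congr 1
  simp only [Matrix.of_apply, var, monom_pow, prod_monom]
  congr 1
  ext j
  simp [Pi.single_apply]

lemma alternant_mul_monom_const (m : Fin n → ℤ) (c : ℤ) :
    alternant m * monom (fun _ => c) = alternant fun i => m i + c := by
  rw [alternant, alternant, sum_mul]
  refine sum_congr rfl fun σ _ => ?_
  rw [smul_mul_assoc, monom_mul]
  rfl

/-- The Schur Laurent polynomial of a weight. -/
def schurPoly (lam : Weight n) : Laurent n :=
  monom (fun _ => lastPart lam) *
    (Matrix.of fun i j : Fin n =>
      hsymmAt (var : Fin n → Laurent n) (lam.1 i - lastPart lam - (i : ℤ) + (j : ℤ))).det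

/-- The strictly decreasing exponent `(λ_i - i)_i` attached to a weight. -/
def shifted (lam : Weight n) : Fin n → ℤ := fun i => lam.1 i - i

lemma shifted_injective : Function.Injective (shifted (n := n)) := by
  intro a b h
  ext i
  have := congrFun h i
  simpa [shifted] using this

lemma shifted_strictAnti (lam : Weight n) : StrictAnti (shifted lam) := by
  intro i j hij
  have h1 := lam.2 hij.le
  have h2 : ((i : ℕ) : ℤ) < (j : ℕ) := by exact_mod_cast hij
  simp only [shifted]
  linarith

lemma exists_shifted_eq {m : Fin n → ℤ} (hm : StrictAnti m) : ∃ lam, shifted lam = m := by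
  refine ⟨⟨fun i => m i + i, ?_⟩, ?_⟩
  · rcases n with _ | n
    · exact fun i => i.elim0
    · refine Fin.antitone_iff_succ_le.2 fun i => ?_
      have := hm i.castSucc_lt_succ
      simp
      omega
  · ext i
    simp [shifted]

lemma lastPart_le (lam : Weight n) (i : Fin n) : lastPart lam ≤ lam.1 i := by
  have h : 0 < n := i.pos
  rw [lastPart, dif_pos h]
  apply lam.2
  rw [Fin.le_def]
  have := i.2
  simp
  omega

/-- This is `det_hsymmAt_mul_det_pow` in the variables `x_l`; constant monomials absorb the shifts
by `λ_n` and `n - 1` that make the exponents natural numbers. -/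
lemma schurPoly_mul_alternant (lam : Weight n) :
    schurPoly lam * alternant (shifted (zeroWeight n)) = alternant (shifted lam) := by
  obtain ⟨a, ha⟩ : ∃ a : Fin n → ℕ, ∀ i, (a i : ℤ) = lam.1 i - lastPart lam + (n - 1 - i) := by
    choose a ha using fun i : Fin n => Int.eq_ofNat_of_zero_le
      (show 0 ≤ lam.1 i - lastPart lam + (n - 1 - i) by
        have := lastPart_le lam i
        have := i.2
        omega)
    exact ⟨a, fun i => (ha i).symm⟩
  have key := det_hsymmAt_mul_det_pow (var : Fin n → Laurent n) a
  rw [det_var_pow, det_var_pow] at key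
  have e1 : alternant (fun i : Fin n => ((n - 1 - (i : ℕ) : ℕ) : ℤ)) =
      alternant (shifted (zeroWeight n)) * monom (fun _ => (n : ℤ) - 1) := by
    rw [alternant_mul_monom_const]
    congr 1
    ext i
    have := i.2
    simp only [shifted, zeroWeight]
    omega
  have e2 : alternant (shifted lam) * monom (fun _ => (n : ℤ) - 1) =
      monom (fun _ => lastPart lam) * alternant (fun i => (a i : ℤ)) := by
    rw [mul_comm (monom _) (alternant _), alternant_mul_monom_const, alternant_mul_monom_const]
    congr 1
    ext i
    rw [ha]
    simp only [shifted]
    ring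
  have hu : monom (fun _ : Fin n => (n : ℤ) - 1) * monom (fun _ => -((n : ℤ) - 1)) = 1 := by
    rw [monom_mul, ← monom_zero]
    congr 1
    ext i
    simp
  have e3 : (Matrix.of fun i j : Fin n => hsymmAt (var : Fin n → Laurent n)
      (lam.1 i - lastPart lam - (i : ℤ) + (j : ℤ))).det =
      (Matrix.of fun i j : Fin n => hsymmAt (var : Fin n → Laurent n)
        ((a i : ℤ) - (n - 1) + j)).det := by
    congr 1
    ext i j : 2
    have h : lam.1 i - lastPart lam - (i : ℤ) + (j : ℤ) = (a i : ℤ) - (n - 1) + j := by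
      rw [ha]
      ring
    simp only [Matrix.of_apply, h]
  rw [e1, ← e3] at key
  have hne : monom (fun _ : Fin n => (n : ℤ) - 1) ≠ 0 :=
    left_ne_zero_of_mul (hu.symm ▸ one_ne_zero)
  refine mul_right_cancel₀ hne ?_
  rw [e2, ← key, schurPoly]
  simp only [mul_assoc]

/-- The coefficients of an alternant are determinants. -/
lemma coeff_alternant (k m : Fin n → ℤ) :
    (alternant k).coeff m =
      ∑ σ : Equiv.Perm (Fin n), (Equiv.Perm.sign σ : ℤ) * if k ∘ σ = m then 1 else 0 := by
  rw [alternant, AddMonoidAlgebra.coeff_sum, Finsupp.finsetSum_apply]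
  refine sum_congr rfl fun σ _ => ?_
  rw [Units.smul_def, AddMonoidAlgebra.coeff_smul_apply, monom, AddMonoidAlgebra.coeff_single,
    Finsupp.single_apply, smul_eq_mul]

lemma comp_perm_eq_of_strictAnti {k m : Fin n → ℤ} (hk : StrictAnti k) (hm : StrictAnti m)
    {σ : Equiv.Perm (Fin n)} (h : k ∘ σ = m) : σ = 1 := by
  have hσ : StrictMono σ := fun i j hij => by
    have := hm hij
    rw [← h] at this
    exact hk.lt_iff_gt.1 this
  have := Subsingleton.elim (hσ.orderIsoOfSurjective σ σ.surjective) (OrderIso.refl _)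
  ext i
  exact congrArg Fin.val (DFunLike.congr_fun this i)

lemma coeff_alternant_of_strictAnti {k m : Fin n → ℤ} (hk : StrictAnti k) (hm : StrictAnti m) :
    (alternant k).coeff m = if k = m then 1 else 0 := by
  rw [coeff_alternant, sum_eq_single 1]
  · simp
  · intro σ _ hσ
    rw [if_neg fun h => hσ (comp_perm_eq_of_strictAnti hk hm h), mul_zero]
  · simp

lemma alternant_zero_ne_zero : alternant (shifted (zeroWeight n)) ≠ 0 := by
  intro h
  have := coeff_alternant_of_strictAnti (shifted_strictAnti (zeroWeight n))
    (shifted_strictAnti (zeroWeight n))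
  simp [h] at this

/-! ### Symmetry, antisymmetry and inversion of the variables -/

/-- Permutation of exponents. -/
def permExp (σ : Equiv.Perm (Fin n)) : (Fin n → ℤ) ≃+ (Fin n → ℤ) where
  toFun m := m ∘ σ
  invFun m := m ∘ σ.symm
  left_inv m := by ext; simp
  right_inv m := by ext; simp
  map_add' _ _ := rfl

/-- Permutation of the variables. -/
def permute (σ : Equiv.Perm (Fin n)) : Laurent n ≃ₐ[ℤ] Laurent n :=
  AddMonoidAlgebra.domCongr ℤ ℤ (permExp σ)

lemma permute_monom (σ : Equiv.Perm (Fin n)) (m : Fin n → ℤ) :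
    permute σ (monom m) = monom (m ∘ σ) :=
  AddMonoidAlgebra.domCongr_single _ _ _

lemma coeff_permute (σ : Equiv.Perm (Fin n)) (P : Laurent n) (m : Fin n → ℤ) :
    (permute σ P).coeff m = P.coeff (m ∘ σ.symm) :=
  AddMonoidAlgebra.coeff_domCongr _ _ _

/-- Inversion of the variables, `x ↦ x⁻¹`. -/
def invVars : Laurent n ≃ₐ[ℤ] Laurent n :=
  AddMonoidAlgebra.domCongr ℤ ℤ (AddEquiv.neg (Fin n → ℤ))

lemma invVars_monom (m : Fin n → ℤ) : invVars (monom m) = monom (-m) :=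
  AddMonoidAlgebra.domCongr_single _ _ _

@[elab_as_elim]
lemma induction_monom {motive : Laurent n → Prop} (P : Laurent n) (zero : motive 0)
    (plus : ∀ P Q, motive P → motive Q → motive (P + Q))
    (smul : ∀ (k : ℤ) m, motive (k • monom m)) : motive P := by
  refine AddMonoidAlgebra.induction_linear P zero plus fun m k => ?_
  simpa [monom] using smul k m

lemma invVars_permute (σ : Equiv.Perm (Fin n)) (P : Laurent n) :
    invVars (permute σ P) = permute σ (invVars P) := by
  induction P using induction_monom with
  | zero => simp
  | plus P Q hP hQ => simp only [map_add, hP, hQ]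
  | smul k m =>
    rw [map_smul, map_smul, map_smul, map_smul, permute_monom, invVars_monom, invVars_monom,
      permute_monom]
    rfl

lemma permute_alternant (π : Equiv.Perm (Fin n)) (m : Fin n → ℤ) :
    permute π (alternant m) = Equiv.Perm.sign π • alternant m := by
  simp only [alternant, map_sum, smul_sum]
  refine Fintype.sum_equiv (Equiv.mulRight π) _ _ fun σ => ?_
  rw [Units.smul_def, map_zsmul, permute_monom, Equiv.coe_mulRight, map_mul, smul_smul,
    mul_comm (Equiv.Perm.sign σ), ← mul_assoc, Int.units_mul_self, one_mul, Units.smul_def]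
  rfl

/-- A quotient of two antisymmetric elements of a domain is symmetric. -/
lemma permute_schurPoly (π : Equiv.Perm (Fin n)) (lam : Weight n) :
    permute π (schurPoly lam) = schurPoly lam := by
  have h := congrArg (permute π) (schurPoly_mul_alternant lam)
  rw [map_mul, permute_alternant, permute_alternant, mul_smul_comm] at h
  have h2 := congrArg (fun Q => Equiv.Perm.sign π • Q) h
  simp only [smul_smul, Int.units_mul_self, one_smul] at h2
  exact mul_right_cancel₀ alternant_zero_ne_zero (h2.trans (schurPoly_mul_alternant lam).symm)

/-- Every antisymmetric Laurent polynomial is a combination of alternants. -/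
lemma exists_eq_sum_alternant (Q : Laurent n)
    (hQ : ∀ σ, permute σ Q = Equiv.Perm.sign σ • Q) :
    ∃ d : Weight n →₀ ℤ, Q = d.sum fun mu k => k • alternant (shifted mu) := by
  have anti : ∀ P : Laurent n, (∀ σ, permute σ P = Equiv.Perm.sign σ • P) → ∀ (σ : Equiv.Perm (Fin n)) m,
      P.coeff (m ∘ σ) = Equiv.Perm.sign σ * P.coeff m := by
    intro P hP σ m
    have h := congrArg (fun T : Laurent n => T.coeff m) (hP σ⁻¹)
    simp only [coeff_permute, Units.smul_def, AddMonoidAlgebra.coeff_smul_apply, smul_eq_mul,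
      Equiv.Perm.sign_inv] at h
    exact h
  set d : Weight n →₀ ℤ := Q.coeff.comapDomain shifted shifted_injective.injOn with hd
  refine ⟨d, ?_⟩
  have hS : ∀ σ, permute σ (d.sum fun mu k => k • alternant (shifted mu)) =
      Equiv.Perm.sign σ • (d.sum fun mu k => k • alternant (shifted mu)) := by
    intro σ
    simp only [Finsupp.sum, map_sum, map_zsmul, permute_alternant, smul_sum]
    exact sum_congr rfl fun mu _ => smul_comm _ _ _
  ext m
  by_cases hm : Function.Injective m
  -- Sorting reduces, by antisymmetry, to strictly decreasing exponents, where only one alternant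
  -- contributes.
  · obtain ⟨σ, hσ⟩ : ∃ σ : Equiv.Perm (Fin n), StrictAnti (m ∘ σ) := by
      refine ⟨Tuple.sort (fun i => OrderDual.toDual (m i)), ?_⟩
      have h := Tuple.monotone_sort (fun i => OrderDual.toDual (m i))
      exact Antitone.strictAnti_of_injective (fun i j hij => h hij)
        (hm.comp (Equiv.injective _))
    obtain ⟨mu, hmu⟩ := exists_shifted_eq hσ
    have h1 := anti Q hQ σ m
    have h2 := anti _ hS σ m
    rw [← hmu] at h1 h2
    have h3 : (d.sum fun mu k => k • alternant (shifted mu)).coeff (shifted mu) =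
        Q.coeff (shifted mu) := by
      rw [Finsupp.sum, AddMonoidAlgebra.coeff_sum, Finsupp.finsetSum_apply]
      simp only [AddMonoidAlgebra.coeff_smul_apply,
        coeff_alternant_of_strictAnti (shifted_strictAnti _) (shifted_strictAnti _),
        shifted_injective.eq_iff]
      simp [hd, eq_comm]
    rw [h3, h1] at h2
    exact mul_left_cancel₀ (Units.ne_zero _) h2
  -- Swapping two equal exponents shows the coefficient equals its own negative.
  · have vanish : ∀ P : Laurent n, (∀ σ, permute σ P = Equiv.Perm.sign σ • P) →
        P.coeff m = 0 := by
      intro P hP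
      simp only [Function.Injective, not_forall] at hm
      obtain ⟨i, j, hij, hne⟩ := hm
      have h := anti P hP (Equiv.swap i j) m
      have e : m ∘ Equiv.swap i j = m := by
        ext l
        simp only [Function.comp_apply, Equiv.swap_apply_def]
        split_ifs with h1 h2
        · rw [h1, hij]
        · rw [h2, hij]
        · rfl
      rw [e, Equiv.Perm.sign_swap hne] at h
      simp at h
      omega
    rw [vanish Q hQ, vanish _ hS]

/-! ### Evaluation on the torus and existence of Schur expansions -/

/-- The character `θ ↦ ∏ θ_i ^ m_i` of the torus. -/
def torusChar (m : Fin n → ℤ) : (Fin n → ℂˣ) →* ℂ where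
  toFun θ := ((∏ i, θ i ^ m i : ℂˣ) : ℂ)
  map_one' := by simp
  map_mul' a b := by simp [mul_zpow, prod_mul_distrib]

lemma torusChar_injective : Function.Injective (torusChar (n := n)) := by
  intro m k h
  ext i
  have h2 := DFunLike.congr_fun h (Pi.mulSingle i (Units.mk0 (2 : ℂ) two_ne_zero))
  have e : ∀ m : Fin n → ℤ, torusChar m (Pi.mulSingle i (Units.mk0 (2 : ℂ) two_ne_zero)) =
      (2 : ℂ) ^ m i := by
    intro m
    simp only [torusChar, MonoidHom.coe_mk, OneHom.coe_mk]
    rw [prod_eq_single i]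
    · simp
    · intro j _ hj
      simp [hj]
    · simp
  rw [e, e] at h2
  have h3 := congrArg (fun z : ℂ => ‖z‖) h2
  simp only [norm_zpow, Complex.norm_ofNat] at h3
  exact zpow_right_injective₀ (by norm_num) (by norm_num) h3

/-- Evaluation of Laurent polynomials at a point of the torus. -/
def evalAt (θ : Fin n → ℂˣ) : Laurent n →ₐ[ℤ] ℂ :=
  AddMonoidAlgebra.lift ℤ ℂ (Fin n → ℤ)
    { toFun := fun m => torusChar m.toAdd θ
      map_one' := by simp [torusChar]
      map_mul' := fun a b => by simp [torusChar, zpow_add, prod_mul_distrib] }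

lemma evalAt_single (θ : Fin n → ℂˣ) (m : Fin n → ℤ) (k : ℤ) :
    evalAt θ (AddMonoidAlgebra.single m k) = k • torusChar m θ :=
  AddMonoidAlgebra.lift_single _ _ _

lemma evalAt_monom (θ : Fin n → ℂˣ) (m : Fin n → ℤ) : evalAt θ (monom m) = torusChar m θ := by
  rw [monom, evalAt_single, one_smul]

/-- Distinct characters are linearly independent (Dedekind). This lifts identities of functions to
identities of Laurent polynomials. -/
lemma eq_zero_of_evalAt_eq_zero {P : Laurent n} (h : ∀ θ, evalAt θ P = 0) : P = 0 := by
  have hli : LinearIndependent ℂ fun m : Fin n → ℤ => (torusChar m : (Fin n → ℂˣ) → ℂ) :=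
    (linearIndependent_monoidHom (Fin n → ℂˣ) ℂ).comp torusChar torusChar_injective
  rw [linearIndependent_iff'] at hli
  have hP : P = ∑ m ∈ P.coeff.support, AddMonoidAlgebra.single m (P.coeff m) := by
    ext k
    rw [AddMonoidAlgebra.coeff_sum, Finsupp.finsetSum_apply]
    simp [AddMonoidAlgebra.coeff_single, Finsupp.single_apply]
  have h0 : ∀ m, P.coeff m = 0 := by
    intro m
    by_cases hm : m ∈ P.coeff.support
    · have := hli P.coeff.support (fun m => (P.coeff m : ℂ)) (by
        ext θ
        have h1 := h θ
        rw [hP, map_sum] at h1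
        simpa [evalAt_single, Finset.sum_apply] using h1) m hm
      exact_mod_cast this
    · exact Finsupp.notMem_support_iff.1 hm
  ext m
  simp [h0 m]

lemma evalAt_schurPoly (θ : Fin n → ℂˣ) (lam : Weight n) :
    evalAt θ (schurPoly lam) = schur lam fun i => (θ i : ℂ) := by
  have hvar : (fun i => evalAt θ (var i)) = fun i => (θ i : ℂ) := by
    ext i
    rw [var, evalAt_monom, torusChar, MonoidHom.coe_mk, OneHom.coe_mk, prod_eq_single i]
    · simp
    · intro j _ hj
      simp [hj]
    · simp
  rw [schurPoly, schur, map_mul, evalAt_monom, AlgHom.map_det]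
  congr 1
  · simp [torusChar, prod_zpow]
  · congr 1
    ext i j
    simp only [AlgHom.mapMatrix_apply, Matrix.map_apply, Matrix.of_apply,
      completeHomogeneous_eq_hsymmAt]
    rw [← hvar]
    exact map_hsymmAt (evalAt θ).toRingHom _ _

lemma isSchurExpansion_iff (lam mu : Weight n) (c : Weight n →₀ ℤ) :
    IsSchurExpansion lam mu c ↔
      schurPoly lam * schurPoly mu = c.sum fun τ k => k • schurPoly τ := by
  have e : ∀ θ : Fin n → ℂˣ, evalAt θ (c.sum fun τ k => k • schurPoly τ) =
      c.sum fun τ k => (k : ℂ) * schur τ fun i => (θ i : ℂ) := by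
    intro θ
    simp [Finsupp.sum, map_sum, evalAt_schurPoly]
  constructor
  · intro h
    refine sub_eq_zero.1 (eq_zero_of_evalAt_eq_zero fun θ => ?_)
    rw [map_sub, map_mul, e, evalAt_schurPoly, evalAt_schurPoly,
      h _ fun i => (θ i).ne_zero, sub_self]
  · intro h θ hθ
    have := congrArg (evalAt fun i => Units.mk0 (θ i) (hθ i)) h
    rw [map_mul, e, evalAt_schurPoly, evalAt_schurPoly] at this
    exact this

/-- Expand the antisymmetric `a_λ s_μ` in alternants and cancel `a_0`. -/
lemma exists_isSchurExpansion (lam mu : Weight n) : ∃ c, IsSchurExpansion lam mu c := by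
  obtain ⟨c, hc⟩ := exists_eq_sum_alternant (alternant (shifted lam) * schurPoly mu) fun σ => by
    rw [map_mul, permute_alternant, permute_schurPoly, smul_mul_assoc]
  refine ⟨c, (isSchurExpansion_iff _ _ _).2
    (mul_right_cancel₀ (alternant_zero_ne_zero (n := n)) ?_)⟩
  rw [mul_right_comm, schurPoly_mul_alternant, hc, Finsupp.sum, Finsupp.sum, sum_mul]
  refine sum_congr rfl fun τ _ => ?_
  rw [smul_mul_assoc, schurPoly_mul_alternant]

lemma exists_sum_lrCoeff (lam mu : Weight n) : ∃ c : Weight n →₀ ℤ,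
    (∀ τ, lrCoeff lam mu τ = c τ) ∧
      alternant (shifted lam) * schurPoly mu = c.sum fun τ k => k • alternant (shifted τ) := by
  have h := (isSchurExpansion_iff _ _ _).1
    (Classical.epsilon_spec (exists_isSchurExpansion lam mu))
  refine ⟨_, fun τ => rfl, ?_⟩
  rw [← schurPoly_mul_alternant, mul_right_comm, h, Finsupp.sum, Finsupp.sum, sum_mul]
  refine sum_congr rfl fun τ _ => ?_
  rw [smul_mul_assoc, schurPoly_mul_alternant]

/-! ### The pairing of alternants and the dual expansion -/

/-- The additive functional `x^m ↦ ∏ f(-m_j)`. For `f` the family of Laurent coefficients of `F`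
it extracts the constant term after multiplication by `∏ F(x_j)`. -/
def functional (f : ℤ → ℂ) : Laurent n →ₗ[ℤ] ℂ :=
  Finsupp.linearCombination ℤ (fun m : Fin n → ℤ => ∏ j, f (-m j)) ∘ₗ
    (AddMonoidAlgebra.coeffLinearEquiv ℤ).toLinearMap

lemma functional_monom (f : ℤ → ℂ) (m : Fin n → ℤ) : functional f (monom m) = ∏ j, f (-m j) := by
  simp [functional, monom]

lemma functional_invVars (f : ℤ → ℂ) (P : Laurent n) :
    functional f (invVars P) = functional (fun k => f (-k)) P := by
  induction P using induction_monom with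
  | zero => simp
  | plus P Q hP hQ => simp only [map_add, hP, hQ]
  | smul k m =>
    rw [map_smul, map_smul, map_smul, invVars_monom, functional_monom, functional_monom]
    rfl

/-- In the double sum over `(σ, π)` the terms depend only on `π σ⁻¹`, so each `σ` contributes one
copy of the determinant. -/
lemma functional_invVars_alternant_mul (f : ℤ → ℂ) (m k : Fin n → ℤ) :
    functional f (invVars (alternant m) * alternant k) =
      (n.factorial : ℂ) * (Matrix.of fun i j : Fin n => f (m j - k i)).det := by
  have h : ∀ σ : Equiv.Perm (Fin n), functional f
      (invVars (Equiv.Perm.sign σ • monom (m ∘ σ)) * alternant k) =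
      (Matrix.of fun i j : Fin n => f (m j - k i)).det := by
    intro σ
    rw [alternant, mul_sum, map_sum, Matrix.det_apply]
    refine Fintype.sum_equiv (Equiv.mulRight σ⁻¹) _ _ fun π => ?_
    rw [Units.smul_def, Units.smul_def, Units.smul_def, map_zsmul, smul_mul_assoc, mul_smul_comm,
      map_zsmul, map_zsmul, smul_smul, invVars_monom, monom_mul, functional_monom,
      Equiv.coe_mulRight, map_mul, Equiv.Perm.sign_inv, mul_comm (Equiv.Perm.sign π),
      Units.val_mul]
    congr 1
    rw [← Equiv.prod_comp σ (fun i => Matrix.of (fun i j : Fin n => f (m j - k i)) _ _)]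
    refine prod_congr rfl fun j _ => ?_
    simp only [Matrix.of_apply, Pi.add_apply, Pi.neg_apply, Function.comp_apply,
      Equiv.Perm.mul_apply, Equiv.Perm.inv_def, Equiv.symm_apply_apply]
    congr 1
    ring
  rw [alternant, map_sum, sum_mul, map_sum, sum_congr rfl fun σ _ => h σ, sum_const, card_univ,
    Fintype.card_perm, Fintype.card_fin, nsmul_eq_mul]

/-- The constant term functional is `functional (Pi.single 0 1)`. -/
lemma functional_single_invVars_alternant_mul {m k : Fin n → ℤ} (hm : StrictAnti m)
    (hk : StrictAnti k) :
    functional (Pi.single 0 1) (invVars (alternant m) * alternant k) =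
      (n.factorial : ℂ) * if k = m then 1 else 0 := by
  rw [functional_invVars_alternant_mul, Matrix.det_apply]
  congr 1
  have h : ∀ σ : Equiv.Perm (Fin n),
      ∏ i, (Matrix.of fun i j : Fin n => (Pi.single 0 1 : ℤ → ℂ) (m j - k i)) (σ i) i =
        if k ∘ σ = m then 1 else 0 := by
    intro σ
    simp only [Matrix.of_apply, Pi.single_apply, prod_ite_zero, prod_const_one, sub_eq_zero,
      mem_univ, true_imp_iff, funext_iff, Function.comp_apply]
    simp only [eq_comm]
  simp only [h]
  rw [sum_eq_single 1]
  · simp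
  · intro σ _ hσ
    rw [if_neg fun h => hσ (comp_perm_eq_of_strictAnti hk hm h), smul_zero]
  · simp

lemma functional_single_mul_sum (d : Weight n →₀ ℤ) (mu : Weight n) :
    functional (Pi.single 0 1) (invVars (alternant (shifted mu)) *
      d.sum fun ν k => k • alternant (shifted ν)) = (n.factorial : ℂ) * d mu := by
  rw [Finsupp.sum, mul_sum, map_sum]
  simp only [mul_smul_comm, map_zsmul, functional_single_invVars_alternant_mul
    (shifted_strictAnti _) (shifted_strictAnti _), shifted_injective.eq_iff]
  rw [sum_eq_single mu]
  · simp [mul_comm]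
  · intro ν _ hν
    simp [hν]
  · intro h
    simp [Finsupp.notMem_support_iff.1 h]

/-- The coefficients `c_{λμ}^τ` for fixed `λ` and `τ` are the coefficients of the expansion of
`s_λ(x⁻¹) s_τ(x)`; in particular only finitely many of them are nonzero. -/
lemma exists_sum_lrCoeff_dual (lam τ : Weight n) : ∃ d : Weight n →₀ ℤ,
    (∀ mu, lrCoeff lam mu τ = d mu) ∧
      invVars (schurPoly lam) * alternant (shifted τ) =
        d.sum fun mu k => k • alternant (shifted mu) := by
  obtain ⟨d, hd⟩ := exists_eq_sum_alternant (invVars (schurPoly lam) * alternant (shifted τ))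
    fun σ => by
      rw [map_mul, permute_alternant, ← invVars_permute, permute_schurPoly, mul_smul_comm]
  refine ⟨d, fun mu => ?_, hd⟩
  obtain ⟨c, hc, hc2⟩ := exists_sum_lrCoeff lam mu
  have h1 := functional_single_mul_sum c τ
  have h2 := functional_single_mul_sum d mu
  have hinv : ∀ P : Laurent n, invVars (invVars P) = P := by
    intro P
    induction P using induction_monom with
    | zero => simp
    | plus P Q hP hQ => simp only [map_add, hP, hQ]
    | smul k m => simp [invVars_monom]
  -- The constant term is invariant under `x ↦ x⁻¹`.
  have heven : (fun k : ℤ => (Pi.single 0 1 : ℤ → ℂ) (-k)) = Pi.single 0 1 := by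
    ext k
    simp [Pi.single_apply]
  -- Moving the factor `a_0` from `a_λ = s_λ a_0` to `s_μ` identifies the pairings that extract `c
  -- τ` and `d mu`.
  have e : invVars (invVars (alternant (shifted τ)) * (alternant (shifted lam) * schurPoly mu)) =
      invVars (alternant (shifted mu)) * (invVars (schurPoly lam) * alternant (shifted τ)) := by
    rw [map_mul, hinv, ← schurPoly_mul_alternant lam, ← schurPoly_mul_alternant mu, map_mul,
      map_mul, map_mul]
    ring
  rw [← hd, ← e, functional_invVars, heven, hc2, h1] at h2
  rw [hc]
  exact_mod_cast mul_left_cancel₀ (Nat.cast_ne_zero.2 n.factorial_ne_zero) h2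

/-- The action of the numbers `c_{λμ}^τ` on determinants of Laurent coefficients. -/
lemma sum_lrCoeff_mul_det (f : ℤ → ℂ) (lam : Weight n) (τ : Weight n) {d : Weight n →₀ ℤ}
    (hd : invVars (schurPoly lam) * alternant (shifted τ) =
        d.sum fun mu k => k • alternant (shifted mu)) :
    ∑ mu ∈ d.support, (d mu : ℂ) *
        (Matrix.of fun i j : Fin n => f (shifted (zeroWeight n) j - shifted mu i)).det =
      (Matrix.of fun i j : Fin n => f (shifted lam j - shifted τ i)).det := by
  have h := congrArg (fun P => functional f (invVars (alternant (shifted (zeroWeight n))) * P)) hd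
  simp only [Finsupp.sum, mul_sum, map_sum, mul_smul_comm, map_zsmul,
    functional_invVars_alternant_mul] at h
  rw [← mul_assoc, ← map_mul, mul_comm (alternant _), schurPoly_mul_alternant,
    functional_invVars_alternant_mul] at h
  refine mul_left_cancel₀ (Nat.cast_ne_zero.2 n.factorial_ne_zero : (n.factorial : ℂ) ≠ 0) ?_
  rw [h, mul_sum]
  refine sum_congr rfl fun mu _ => ?_
  rw [zsmul_eq_mul]
  ring

lemma schur_zeroWeight {θ : Fin n → ℂ} (hθ : ∀ i, θ i ≠ 0) : schur (zeroWeight n) θ = 1 := by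
  have h : schurPoly (zeroWeight n) = 1 :=
    mul_right_cancel₀ alternant_zero_ne_zero
      ((schurPoly_mul_alternant (zeroWeight n)).trans (one_mul _).symm)
  have := evalAt_schurPoly (fun i => Units.mk0 (θ i) (hθ i)) (zeroWeight n)
  rw [h, map_one] at this
  exact this.symm

end Laurent

end

/-! ### Conclusion: cancelling the Schur quotients -/

theorem mainTheorem1 (n : ℕ) (θ : Fin n → ℂ) (hθ : ∀ j, θ j ≠ 0)
    (F : ℂ → ℂ) (hF : IsBasicFunction F)
    (r R : ℝ≥0∞) (hFan : AnalyticOnNhd ℂ F (annulus r R))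
    (hθA : ∀ j, (θ j)⁻¹ ∈ annulus r R) (hFθ : ∀ j, F ((θ j)⁻¹) ≠ 0)
    (ρ : ℝ) (hρ : 0 < ρ) (hρA : (ρ : ℂ) ∈ annulus r R)
    (lam τ : Weight n) (hlam : schur lam θ ≠ 0)
    (hmu : ∀ mu : Weight n, lrCoeff lam mu τ ≠ 0 → schur mu θ ≠ 0) :
    HasSum
      (fun mu : Weight n =>
        initialWeight θ F ρ mu * (lrCoeff lam mu τ : ℂ) *
          (schur τ θ / (schur lam θ * schur mu θ)))
      (transitionKernel θ F ρ lam τ) := by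
  obtain ⟨d, hd, hsum⟩ := Laurent.exists_sum_lrCoeff_dual lam τ
  have hshift : ∀ lam mu : Weight n, ∀ i j : Fin n,
      lam.1 j - (j : ℤ) - mu.1 i + (i : ℤ) = Laurent.shifted lam j - Laurent.shifted mu i := by
    intro lam mu i j
    simp only [Laurent.shifted]
    ring
  have key := Laurent.sum_lrCoeff_mul_det (laurentCoeff F ρ) lam τ hsum
  have hval : transitionKernel θ F ρ lam τ = ∑ mu ∈ d.support,
      initialWeight θ F ρ mu * (lrCoeff lam mu τ : ℂ) *
          (schur τ θ / (schur lam θ * schur mu θ)) := by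
    simp only [initialWeight, transitionKernel, hshift]
    rw [← key, Finset.sum_div, Finset.mul_sum]
    refine Finset.sum_congr rfl fun mu hm => ?_
    have hne : schur mu θ ≠ 0 := hmu mu (by rw [hd]; exact Finsupp.mem_support_iff.1 hm)
    rw [hd, Laurent.schur_zeroWeight hθ]
    field_simp
  rw [hval]
  refine hasSum_sum_of_ne_finset_zero fun mu hm => ?_
  rw [hd, Finsupp.notMem_support_iff.1 hm]
  simp
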